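/- Let $\Gamma$ be a finite simple graph, let $G=(V,E)$ be a connected subgraph of $\Gamma$, and let $\delta V$ be the set of vertices of $\Gamma$ outside $V$ that are adjacent in $\Gamma$ to a vertex of $V$. Let $R,S\subseteq\delta V$ with $|V|=|R\times S|$, let $\alpha_0>0$ and $t\ge 0$ be real, and let $p,q\in[1,\infty]$ with $1/p+1/q=1$. All spaces $\ell^p(\cdot)$ below are complex. Background Green's function. Let $y\sim x$ mean that $\{x,y\}$ is an edge of $G$ if $x,y\in V$, and an edge of $\Gamma$ if one of $x,y$ lies in $V$ and the other in $\delta V$. Let $G_0$ be the matrix indexed by $V\cup\delta V$ whose $j$-th column is the unique solution $u$ of $$\sum_{y\sim x}[u(x)-u(y)]+\alpha_0u(x)=f(x)\ (x\in V),\qquad t\,u(x)+\sum_{y\in V,\,y\sim x}[u(x)-u(y)]=g(x)\ (x\in\delta V),$$ for a unit source at $j$ (that is, $f=\delta_j$, $g=0$ if $j\in V$, and $f=0$, $g=\delta_j$ if $j\in\delta V$). For sets $U,W$ let $G_0^{U;W}$ be the submatrix with rows in $U$ and columns in $W$. Forward Born operators. For $j\ge1$ and $\eta_1,\dots,\eta_j\in\ell^p(V)$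 define $K_j(\eta_1,\dots,\eta_j)\in\ell^p(R\times S)$ by $$K_j(\eta_1,\dots,\eta_j)(r,s)=-(-\alpha_0)^j\,G_0^{r;V}D_{\eta_1}G_0^{V;V}D_{\eta_2}\cdots G_0^{V;V}D_{\eta_j}G_0^{V;s},$$ where $D_\eta$ is the diagonal matrix with diagonal $\eta$. Suppose that $K_1:\ell^p(V)\to\ell^p(R\times S)$ is invertible. Inverse Born series. Let $\mathcal K_1=K_1^{-1}$ and, for $j\ge2$, $$\mathcal K_j=-\Big(\sum_{m=1}^{j-1}\mathcal K_m\sum_{i_1+\cdots+i_m=j}K_{i_1}\otimes\cdots\otimes K_{i_m}\Big)\,\mathcal K_1\otimes\cdots\otimes\mathcal K_1 ,$$ with all $i_k\ge1$. The inverse Born series for data $\phi\in\ell^p(R\times S)$ is $\sum_{j\ge1}\mathcal K_j(\phi,\dots,\phi)$. Constants. Let $$\nu_p=\alpha_0\,\Big\|\big(\|G_0^{r;V}\|_{\ell^q(V)}\big)_{r}\Big\|_{\ell^p(R)}\Big\|\big(\|G_0^{V;s}\|_{\ell^q(V)}\big)_{s}\Big\|_{\ell^p(S)},\quad \mu_p=\alpha_0\max_{v\in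 V}\|G_0^{V;v}\|_{\ell^q(V)},\quad C_p=\min_{\|\eta\|_p=1}\|K_1\eta\|_p,$$ $$r_p=\frac{C_p}{\mu_p}\Big[1-2\frac{\nu_p}{C_p}\Big(\sqrt{1+\frac{C_p}{\nu_p}}-1\Big)\Big].$$ Proposition. Let $D$ be a compact subset of $\{\phi\in\ell^p(R\times S):\|\phi\|_p<r_p\}$. Then the inverse Born series converges absolutely for every $\phi\in D$, and there is a constant $M=M(D,p)$ such that for all $\phi_1,\phi_2\in D$ the limits $\psi_1,\psi_2$ of the inverse Born series for the data $\phi_1,\phi_2$ satisfy $$\|\psi_1-\psi_2\|_p\le M\,\|\phi_1-\phi_2\|_p .$$ -/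

import Mathlib

open scoped ENNReal
open scoped Classical

noncomputable section

namespace GraphTomography

variable {W : Type*} {Γ : SimpleGraph W}

/-- The vertex boundary `δV` of a subgraph `G = (V, E)` of `Γ`: the vertices of `Γ` outside `V` that
are adjacent in `Γ` to a vertex of `V`. -/
def boundary (G : Γ.Subgraph) : Set W :=
  {x | x ∉ G.verts ∧ ∃ y ∈ G.verts, Γ.Adj x y}

/-- The disjoint union `V ∪ δV`. -/
abbrev Node (G : Γ.Subgraph) : Type _ := ↥G.verts ⊕ ↥(boundary G)

variable [Fintype W]

/-- The linear operator of the background problem (vertex potential `η = 0`). It maps a function `u`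
on `V ∪ δV` to the function whose value is
`∑_{y ∼ x} (u x - u y) + α₀ u x` at `x ∈ V` (the neighbours `y` of `x` lie in `V` or in `δV`), and
`t u x + ∑_{y ∈ V, y ∼ x} (u x - u y)` at `x ∈ δV` (the Robin boundary condition). -/
def backgroundOp (G : Γ.Subgraph) (α₀ t : ℝ) : (Node G → ℝ) →ₗ[ℝ] (Node G → ℝ) where
  toFun u := Sum.elim
    (fun x : ↥G.verts =>
      (∑ y : ↥G.verts, if G.Adj x y then u (Sum.inl x) - u (Sum.inl y) else 0)
        + (∑ y : ↥(boundary G), if Γ.Adj x y then u (Sum.inl x) - u (Sum.inr y) else 0)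
        + α₀ * u (Sum.inl x))
    (fun x : ↥(boundary G) =>
      t * u (Sum.inr x)
        + ∑ y : ↥G.verts, if Γ.Adj x y then u (Sum.inr x) - u (Sum.inl y) else 0)
  map_add' u v := by
    ext (x | x)
    · have h1 : ∀ (P : Prop) (a b c d : ℝ), (if P then a + b - (c + d) else 0)
          = (if P then a - c else 0) + (if P then b - d else 0) := by
        intro P a b c d; split_ifs <;> ring
      simp only [Sum.elim_inl, Pi.add_apply, h1, Finset.sum_add_distrib]
      ring
    · have h1 : ∀ (P : Prop) (a b c d : ℝ), (if P then a + b - (c + d) else 0)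
          = (if P then a - c else 0) + (if P then b - d else 0) := by
        intro P a b c d; split_ifs <;> ring
      simp only [Sum.elim_inr, Pi.add_apply, h1, Finset.sum_add_distrib]
      ring
  map_smul' a u := by
    have h1 : ∀ (P : Prop) (b c : ℝ), (if P then a * b - a * c else 0)
        = a * (if P then b - c else 0) := by
      intro P b c; split_ifs <;> ring
    ext (x | x)
    · simp only [Sum.elim_inl, Pi.smul_apply, smul_eq_mul, RingHom.id_apply, h1,
        ← Finset.mul_sum]
      ring
    · simp only [Sum.elim_inr, Pi.smul_apply, smul_eq_mul, RingHom.id_apply, h1,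
        ← Finset.mul_sum]
      ring

/-- The background problem is uniquely solvable, so that the Green's function below is a genuine
inverse. -/
theorem backgroundOp_bijective (G : Γ.Subgraph) {α₀ t : ℝ} (hα : 0 < α₀) (ht : 0 ≤ t) :
    Function.Bijective (backgroundOp G α₀ t) := by
  have hinj : Function.Injective (backgroundOp G α₀ t) := by
    rw [injective_iff_map_eq_zero]
    intro u hu
    have hV : ∀ x : ↥G.verts,
        (∑ y : ↥G.verts, if G.Adj x y then u (Sum.inl x) - u (Sum.inl y) else 0)
        + (∑ y : ↥(boundary G), if Γ.Adj x y then u (Sum.inl x) - u (Sum.inr y) else 0)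
        + α₀ * u (Sum.inl x) = 0 := fun x => congrFun hu (Sum.inl x)
    have hB : ∀ x : ↥(boundary G), t * u (Sum.inr x)
        + (∑ y : ↥G.verts, if Γ.Adj x y then u (Sum.inr x) - u (Sum.inl y) else 0) = 0 :=
      fun x => congrFun hu (Sum.inr x)
    -- Dirichlet form of the interior edges
    have e1 : 0 ≤ ∑ x : ↥G.verts, ∑ y : ↥G.verts,
        u (Sum.inl x) * (if G.Adj x y then u (Sum.inl x) - u (Sum.inl y) else 0) := by
      have hs : ∑ x : ↥G.verts, ∑ y : ↥G.verts,
          u (Sum.inl x) * (if G.Adj x y then u (Sum.inl x) - u (Sum.inl y) else 0)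
          = ∑ x : ↥G.verts, ∑ y : ↥G.verts,
          u (Sum.inl y) * (if G.Adj x y then u (Sum.inl y) - u (Sum.inl x) else 0) := by
        rw [Finset.sum_comm]
        simp only [G.adj_comm]
      have h2 : 0 ≤ ∑ x : ↥G.verts, ∑ y : ↥G.verts,
          (u (Sum.inl x) * (if G.Adj x y then u (Sum.inl x) - u (Sum.inl y) else 0)
          + u (Sum.inl y) * (if G.Adj x y then u (Sum.inl y) - u (Sum.inl x) else 0)) := by
        refine Finset.sum_nonneg fun x _ => Finset.sum_nonneg fun y _ => ?_
        split_ifs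
        · nlinarith [sq_nonneg (u (Sum.inl x) - u (Sum.inl y))]
        · simp
      simp only [Finset.sum_add_distrib] at h2
      linarith
    -- Dirichlet form of the edges between the interior and the boundary
    have e2 : (∑ x : ↥G.verts, ∑ y : ↥(boundary G),
          u (Sum.inl x) * (if Γ.Adj x y then u (Sum.inl x) - u (Sum.inr y) else 0))
        + (∑ y : ↥(boundary G), ∑ x : ↥G.verts,
          u (Sum.inr y) * (if Γ.Adj y x then u (Sum.inr y) - u (Sum.inl x) else 0))
        = ∑ x : ↥G.verts, ∑ y : ↥(boundary G),
          (if Γ.Adj x y then (u (Sum.inl x) - u (Sum.inr y)) ^ 2 else 0) := by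
      rw [Finset.sum_comm (s := (Finset.univ : Finset ↥(boundary G))), ← Finset.sum_add_distrib]
      refine Finset.sum_congr rfl fun x _ => ?_
      rw [← Finset.sum_add_distrib]
      refine Finset.sum_congr rfl fun y _ => ?_
      rw [Γ.adj_comm y x]
      split_ifs <;> ring
    have s1 : ∑ x : ↥G.verts, u (Sum.inl x) *
        ((∑ y : ↥G.verts, if G.Adj x y then u (Sum.inl x) - u (Sum.inl y) else 0)
        + (∑ y : ↥(boundary G), if Γ.Adj x y then u (Sum.inl x) - u (Sum.inr y) else 0)
        + α₀ * u (Sum.inl x)) = 0 := Finset.sum_eq_zero fun x _ => by rw [hV x, mul_zero]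
    have s2 : ∑ x : ↥(boundary G), u (Sum.inr x) * (t * u (Sum.inr x)
        + (∑ y : ↥G.verts, if Γ.Adj x y then u (Sum.inr x) - u (Sum.inl y) else 0)) = 0 :=
      Finset.sum_eq_zero fun x _ => by rw [hB x, mul_zero]
    simp only [mul_add, Finset.sum_add_distrib] at s1 s2
    simp only [Finset.mul_sum] at s1 s2
    have p1 : 0 ≤ ∑ x : ↥G.verts, u (Sum.inl x) * (α₀ * u (Sum.inl x)) :=
      Finset.sum_nonneg fun x _ => by nlinarith [mul_self_nonneg (u (Sum.inl x))]
    have p2 : 0 ≤ ∑ x : ↥(boundary G), u (Sum.inr x) * (t * u (Sum.inr x)) :=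
      Finset.sum_nonneg fun x _ => by nlinarith [mul_self_nonneg (u (Sum.inr x))]
    have p3 : 0 ≤ ∑ x : ↥G.verts, ∑ y : ↥(boundary G),
        (if Γ.Adj x y then (u (Sum.inl x) - u (Sum.inr y)) ^ 2 else 0) :=
      Finset.sum_nonneg fun x _ => Finset.sum_nonneg fun y _ => by
        split_ifs <;> positivity
    have q1 : ∑ x : ↥G.verts, u (Sum.inl x) * (α₀ * u (Sum.inl x)) = 0 := by linarith
    have q3 : ∑ x : ↥G.verts, ∑ y : ↥(boundary G),
        (if Γ.Adj x y then (u (Sum.inl x) - u (Sum.inr y)) ^ 2 else 0) = 0 := by linarith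
    have zV : ∀ x : ↥G.verts, u (Sum.inl x) = 0 := by
      intro x
      have := (Finset.sum_eq_zero_iff_of_nonneg (fun x _ => by
        nlinarith [mul_self_nonneg (u (Sum.inl x))])).1 q1 x (Finset.mem_univ x)
      rcases mul_eq_zero.1 this with h | h
      · exact h
      · exact (mul_eq_zero.1 h).resolve_left hα.ne'
    have zB : ∀ y : ↥(boundary G), u (Sum.inr y) = 0 := by
      intro y
      obtain ⟨-, x, hx, hxy⟩ := y.2
      have h1 := (Finset.sum_eq_zero_iff_of_nonneg (fun x _ => Finset.sum_nonneg fun y _ => by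
        split_ifs <;> positivity)).1 q3 ⟨x, hx⟩ (Finset.mem_univ _)
      have h2 := (Finset.sum_eq_zero_iff_of_nonneg (fun y _ => by
        split_ifs <;> positivity)).1 h1 y (Finset.mem_univ _)
      rw [if_pos hxy.symm, zV] at h2
      simpa using h2
    funext x
    rcases x with x | x
    · exact zV x
    · exact zB x
  exact ⟨hinj, LinearMap.injective_iff_surjective.1 hinj⟩

/-- The background Green's function `G₀`, as a matrix indexed by `V ∪ δV`: its `j`-th column is the
solution of the background problem for a unit source at `j` (the inverse of the matrix of
`backgroundOp`). The entries are real and regarded as complex numbers. -/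
def greenMatrix (G : Γ.Subgraph) (α₀ t : ℝ) : Matrix (Node G) (Node G) ℂ :=
  ((LinearMap.toMatrix' (backgroundOp G α₀ t))⁻¹).map (fun a : ℝ => (a : ℂ))

/-- `bornChain G α₀ t j η = G₀^{·;V} D_{η₁} G₀^{V;V} D_{η₂} ⋯ G₀^{V;V} D_{η_j} G₀^{V;·}`, where
`D_η` is the diagonal matrix with diagonal `η`. -/
def bornChain (G : Γ.Subgraph) (α₀ t : ℝ) :
    (j : ℕ) → (Fin j → ↥G.verts → ℂ) → Matrix (Node G) (Node G) ℂ
  | 0, _ => greenMatrix G α₀ t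
  | j + 1, η =>
      (greenMatrix G α₀ t).submatrix id Sum.inl * Matrix.diagonal (η 0) *
        (bornChain G α₀ t j (Fin.tail η)).submatrix Sum.inl id

theorem bornChain_update_add (G : Γ.Subgraph) (α₀ t : ℝ) (j : ℕ) (η : Fin j → ↥G.verts → ℂ)
    (i : Fin j) (a b : ↥G.verts → ℂ) :
    bornChain G α₀ t j (Function.update η i (a + b)) =
      bornChain G α₀ t j (Function.update η i a) + bornChain G α₀ t j (Function.update η i b) := by
  induction j with
  | zero => exact i.elim0
  | succ j ih =>
    refine Fin.cases ?_ (fun k => ?_) i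
    · have h : ∀ c, Fin.tail (Function.update η 0 c) = Fin.tail η := fun c =>
        Fin.tail_update_zero η c
      have hd : Matrix.diagonal (a + b) = Matrix.diagonal a + Matrix.diagonal b :=
        (Matrix.diagonal_add a b).symm
      simp only [bornChain, h, Function.update_self, hd, Matrix.mul_add, Matrix.add_mul]
    · have h0 : ∀ c, Function.update η k.succ c 0 = η 0 := fun c =>
        Function.update_of_ne (Fin.succ_ne_zero k).symm c η
      have h : ∀ c, Fin.tail (Function.update η k.succ c) = Function.update (Fin.tail η) k c :=
        fun c => Fin.tail_update_succ η k c
      simp only [bornChain, h, h0, ih]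
      rw [← Matrix.mul_add]
      rfl

theorem bornChain_update_smul (G : Γ.Subgraph) (α₀ t : ℝ) (j : ℕ) (η : Fin j → ↥G.verts → ℂ)
    (i : Fin j) (c : ℂ) (a : ↥G.verts → ℂ) :
    bornChain G α₀ t j (Function.update η i (c • a)) =
      c • bornChain G α₀ t j (Function.update η i a) := by
  induction j with
  | zero => exact i.elim0
  | succ j ih =>
    refine Fin.cases ?_ (fun k => ?_) i
    · have h : ∀ c, Fin.tail (Function.update η 0 c) = Fin.tail η := fun c =>
        Fin.tail_update_zero η c
      have hd : Matrix.diagonal (c • a) = c • Matrix.diagonal a :=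
        Matrix.diagonal_smul c a
      simp only [bornChain, h, Function.update_self, hd, Matrix.mul_smul, Matrix.smul_mul]
    · have h0 : ∀ c, Function.update η k.succ c 0 = η 0 := fun c =>
        Function.update_of_ne (Fin.succ_ne_zero k).symm c η
      have h : ∀ c, Fin.tail (Function.update η k.succ c) = Function.update (Fin.tail η) k c :=
        fun c => Fin.tail_update_succ η k c
      simp only [bornChain, h, h0, ih]
      rw [← Matrix.mul_smul]
      rfl

theorem continuous_bornChain (G : Γ.Subgraph) (α₀ t : ℝ) (j : ℕ) :
    Continuous (bornChain G α₀ t j) := by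
  induction j with
  | zero => exact continuous_const
  | succ j ih =>
    have ht : Continuous fun η : Fin (j + 1) → ↥G.verts → ℂ => Fin.tail η :=
      continuous_pi fun k => continuous_apply k.succ
    exact (continuous_const.matrix_mul (continuous_apply 0).matrix_diagonal).matrix_mul
      ((ih.comp ht).matrix_submatrix _ _)

/-- `ℓ^p(V)`, with complex values. -/
abbrev Potential (G : Γ.Subgraph) (p : ℝ≥0∞) : Type _ := PiLp p (fun _ : ↥G.verts => ℂ)

/-- `ℓ^p(R × S)`, with complex values, for sets `R`, `S` of boundary vertices. -/
abbrev Data {G : Γ.Subgraph} (R S : Set ↥(boundary G)) (p : ℝ≥0∞) : Type _ :=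
  PiLp p (fun _ : ↥R × ↥S => ℂ)

variable {G : Γ.Subgraph} (R S : Set ↥(boundary G)) (α₀ t : ℝ) (p : ℝ≥0∞) [Fact (1 ≤ p)]

/-- The forward Born operator `K_j : ℓ^p(V)^j → ℓ^p(R × S)`,
`K_j(η₁, …, η_j)(r, s) = -(-α₀)^j G₀^{r;V} D_{η₁} G₀^{V;V} D_{η₂} ⋯ G₀^{V;V} D_{η_j} G₀^{V;s}`.
With this sign, `∑_{j ≥ 1} K_j(η, …, η) = G₀ - Λ_η` on `R × S`. -/
def bornOp (j : ℕ) :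
    ContinuousMultilinearMap ℂ (fun _ : Fin j => Potential G p) (Data R S p) where
  toFun η := WithLp.toLp p fun rs =>
    -(-(α₀ : ℂ)) ^ j * bornChain G α₀ t j (fun i => (η i).ofLp) (Sum.inr rs.1) (Sum.inr rs.2)
  map_update_add' η i a b := by
    rename_i inst
    obtain rfl : inst = instDecidableEqFin j := Subsingleton.elim _ _
    have h : ∀ c : Potential G p, (fun k => (Function.update η i c k).ofLp)
        = Function.update (fun k => (η k).ofLp) i c.ofLp := by
      intro c; funext k
      by_cases hk : k = i
      · subst hk; simp
      · simp [hk]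
    ext rs
    simp only [h, WithLp.ofLp_add, bornChain_update_add, Matrix.add_apply, PiLp.add_apply]
    ring
  map_update_smul' η i c a := by
    rename_i inst
    obtain rfl : inst = instDecidableEqFin j := Subsingleton.elim _ _
    have h : ∀ c : Potential G p, (fun k => (Function.update η i c k).ofLp)
        = Function.update (fun k => (η k).ofLp) i c.ofLp := by
      intro c; funext k
      by_cases hk : k = i
      · subst hk; simp
      · simp [hk]
    ext rs
    simp only [h, WithLp.ofLp_smul, bornChain_update_smul, Matrix.smul_apply, PiLp.smul_apply,
      smul_eq_mul]
    ring
  cont := by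
    refine (PiLp.continuous_toLp p _).comp (continuous_pi fun rs => continuous_const.mul ?_)
    have h : Continuous fun η : Fin j → Potential G p => fun i => (η i).ofLp :=
      continuous_pi fun i => (PiLp.continuous_ofLp p _).comp (continuous_apply i)
    exact ((continuous_bornChain G α₀ t j).comp h).matrix_elem _ _

/-- The forward Born series `η ↦ ∑_{j ≥ 1} K_j(η, …, η)` as a formal power series (its constant term
is zero). -/
def bornSeries : FormalMultilinearSeries ℂ (Potential G p) (Data R S p)
  | 0 => 0
  | j + 1 => bornOp R S α₀ t p (j + 1)

/-- The linear term `K₁` as a linear operator from `ℓ^p(V)` to `ℓ^p(R × S)`. -/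
def bornLinear : Potential G p →L[ℂ] Data R S p :=
  continuousMultilinearCurryFin1 ℂ (Potential G p) (Data R S p) (bornSeries R S α₀ t p 1)

/-- The linear isomorphism given by an invertible `K₁`. -/
def bornEquiv (h : Function.Bijective (bornLinear R S α₀ t p)) :
    Potential G p ≃L[ℂ] Data R S p :=
  (LinearEquiv.ofBijective (bornLinear R S α₀ t p).toLinearMap h).toContinuousLinearEquiv

/-- The inverse Born series for invertible `K₁`: its terms `𝒦_j` are given by `𝒦_0 = 0`,
`𝒦_1 = K₁⁻¹` and
`𝒦_j = -(∑_{m=1}^{j-1} 𝒦_m ∑_{i₁+⋯+i_m=j} K_{i₁} ⊗ ⋯ ⊗ K_{i_m}) (𝒦_1 ⊗ ⋯ ⊗ 𝒦_1)` for `j ≥ 2`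
(all `i_k ≥ 1`). This is the recursion that defines `FormalMultilinearSeries.leftInv`. -/
def inverseBornSeries (h : Function.Bijective (bornLinear R S α₀ t p)) :
    FormalMultilinearSeries ℂ (Data R S p) (Potential G p) :=
  (bornSeries R S α₀ t p).leftInv (bornEquiv R S α₀ t p h) 0

/-- `ν_p = α₀ ‖G₀^{R;V}‖ ‖G₀^{V;S}‖`, where both norms are mixed norms: the `ℓ^p` norm, over the
index in `R` or `S`, of the `ℓ^q(V)` norms. -/
def nuConst (q : ℝ≥0∞) : ℝ :=
  α₀ * ‖(WithLp.toLp p fun r : ↥R =>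
        ‖(WithLp.toLp q fun v : ↥G.verts =>
          greenMatrix G α₀ t (Sum.inr r) (Sum.inl v) : PiLp q fun _ : ↥G.verts => ℂ)‖ :
        PiLp p fun _ : ↥R => ℝ)‖
    * ‖(WithLp.toLp p fun s : ↥S =>
        ‖(WithLp.toLp q fun v : ↥G.verts =>
          greenMatrix G α₀ t (Sum.inl v) (Sum.inr s) : PiLp q fun _ : ↥G.verts => ℂ)‖ :
        PiLp p fun _ : ↥S => ℝ)‖

/-- `μ_p = α₀ max_{v ∈ V} ‖G₀^{V;v}‖_{ℓ^q(V)}`. -/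
def muConst (G : Γ.Subgraph) (α₀ t : ℝ) (q : ℝ≥0∞) : ℝ :=
  α₀ * ⨆ v : ↥G.verts, ‖(WithLp.toLp q fun w : ↥G.verts =>
    greenMatrix G α₀ t (Sum.inl w) (Sum.inl v) : PiLp q fun _ : ↥G.verts => ℂ)‖

/-- `C_p = min_{‖η‖_p = 1} ‖K₁ η‖_p`. -/
def lowerConst : ℝ :=
  sInf {c : ℝ | ∃ η : Potential G p, ‖η‖ = 1 ∧ c = ‖bornLinear R S α₀ t p η‖}

/-- `r_p = (C_p / μ_p) (1 - 2 (ν_p / C_p) (√(1 + C_p / ν_p) - 1))`, where `q` is the exponent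
conjugate to `p`. -/
def convRadius (q : ℝ≥0∞) : ℝ :=
  lowerConst R S α₀ t p / muConst G α₀ t q *
    (1 - 2 * (nuConst R S α₀ t p q / lowerConst R S α₀ t p) *
      (Real.sqrt (1 + lowerConst R S α₀ t p / nuConst R S α₀ t p q) - 1))

end GraphTomography

end

open GraphTomography

/-! The inverse Born series is a formal left inverse of the forward series. Since `K₁` is
invertible, `leftInv_eq_rightInv` identifies it with the formal right inverse, whose recursion
admits a scalar majorant. Hölder's inequality gives `‖K_{j+1}‖ ≤ ν μ^j` (`norm_bornOp_succ_le`), and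
`‖K₁⁻¹‖ ≤ 1 / C`. Writing `X` for `μ` times a partial sum of `a^k ‖𝒦_k‖`, the next value is at most
`μ a / C + (ν / C) X² / (1 - X)`. These values stay bounded while this map has a fixed point in `[0,
1)`, that is, while `μ a` is at most the maximum of `C X - ν X² / (1 - X)`; that maximum is `μ r_p`.
So the radius of convergence is at least `r_p` (`ofReal_convRadius_le_radius`). A compact set of
data lies in a strictly smaller closed ball, where termwise differences are dominated by a
convergent series (`exists_lipschitz_of_lt_radius`). -/

/-! ### Formal power series: radius of the inverse series and Lipschitz bounds. -/

namespace FormalMultilinearSeries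

variable {𝕜 : Type*} [NontriviallyNormedField 𝕜]
  {E : Type*} [NormedAddCommGroup E] [NormedSpace 𝕜 E]
  {F : Type*} [NormedAddCommGroup F] [NormedSpace 𝕜 F]

/-- Explicit majorant bound for the partial sums of the right inverse of a power series, up to the
critical value of `x ↦ c x - ν μ x² / (1 - μ x)`. -/
theorem sum_norm_rightInv_le (P : FormalMultilinearSeries 𝕜 E F) (i : E ≃L[𝕜] F) (x : E)
    {c ν μ a : ℝ} (hc : 0 < c) (hν : 0 < ν) (hμ : 0 < μ) (ha : 0 ≤ a)
    (hi : ‖(i.symm : F →L[𝕜] E)‖ ≤ c⁻¹) (hP : ∀ n, ‖P n‖ ≤ ν / μ * μ ^ n)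
    (har : a ≤ c / μ * (1 - 2 * (ν / c) * (Real.sqrt (1 + c / ν) - 1))) {n : ℕ} (hn : 1 ≤ n) :
    μ * ∑ k ∈ Finset.Ico 1 n, a ^ k * ‖P.rightInv i x k‖ ≤ 1 - (Real.sqrt (1 + c / ν))⁻¹ := by
  -- The derivative of `c X - ν X² / (1 - X)` vanishes when `(1 - X)⁻² = 1 + c / ν`, so `1 - y⁻¹` is
  -- the critical point. It serves as an invariant upper bound in the induction.
  set y := Real.sqrt (1 + c / ν) with hy
  have hcν : 0 < c / ν := div_pos hc hν
  have hysq : y ^ 2 = 1 + c / ν := Real.sq_sqrt (by positivity)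
  have hy1 : 1 < y := by
    rw [hy, Real.lt_sqrt (by norm_num)]; linarith
  have hy0 : 0 < y := by linarith
  have hcy : c = ν * (y ^ 2 - 1) := by rw [hysq]; field_simp; ring
  have hlt : y⁻¹ < 1 := inv_lt_one_of_one_lt₀ hy1
  induction n, hn using Nat.le_induction with
  | base => simpa using hlt.le
  | succ n hn ih =>
    set S := ∑ k ∈ Finset.Ico 1 n, a ^ k * ‖P.rightInv i x k‖ with hS
    have hS0 : 0 ≤ μ * S := by positivity
    have hmain := radius_rightInv_pos_of_radius_pos_aux2 (x := x) (n := n) (by omega) P i hμ.le ha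
      (by positivity : 0 ≤ ν / μ) hP
    have hgeom : ∑ k ∈ Finset.Ico 2 (n + 1), (μ * S) ^ k ≤ (1 - y⁻¹) ^ 2 / y⁻¹ := by
      have hS1 : μ * S < 1 := ih.trans_lt (by have := inv_pos.2 hy0; linarith)
      rw [geom_sum_Ico' hS1.ne (by omega)]
      have h1 : y⁻¹ ≤ 1 - μ * S := by linarith
      have h2 : 0 ≤ (μ * S) ^ (n + 1) := by positivity
      have h3 : (μ * S) ^ 2 ≤ (1 - y⁻¹) ^ 2 := by gcongr
      gcongr
      linarith
    rw [← hS] at hmain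
    -- At the largest admissible `a` this is the fixed-point equation, an identity once `c = ν (y² -
    -- 1)` is substituted.
    have hbound : c⁻¹ * a + c⁻¹ * (ν / μ) * ((1 - y⁻¹) ^ 2 / y⁻¹) ≤ (1 - y⁻¹) / μ := by
      have h1 : c⁻¹ * a ≤ c⁻¹ * (c / μ * (1 - 2 * (ν / c) * (y - 1))) := by gcongr
      refine (add_le_add_left h1 _).trans (le_of_eq ?_)
      have h2 : y ^ 2 - 1 ≠ 0 := by nlinarith
      rw [hcy]
      field_simp
      ring
    calc μ * ∑ k ∈ Finset.Ico 1 (n + 1), a ^ k * ‖P.rightInv i x k‖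
        ≤ μ * (c⁻¹ * a + c⁻¹ * (ν / μ) * ((1 - y⁻¹) ^ 2 / y⁻¹)) := by
          refine mul_le_mul_of_nonneg_left (hmain.trans ?_) hμ.le
          gcongr
      _ ≤ μ * ((1 - y⁻¹) / μ) := by gcongr
      _ = 1 - y⁻¹ := by field_simp

/-- Bounded terms suffice for a lower bound on the radius, and each term with index at least 1 is
dominated by a partial sum at the critical value of `a`. -/
theorem ofReal_le_radius_rightInv (P : FormalMultilinearSeries 𝕜 E F) (i : E ≃L[𝕜] F) (x : E)
    {c ν μ : ℝ} (hc : 0 < c) (hν : 0 < ν) (hμ : 0 < μ)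
    (hi : ‖(i.symm : F →L[𝕜] E)‖ ≤ c⁻¹) (hP : ∀ n, ‖P n‖ ≤ ν / μ * μ ^ n) :
    ENNReal.ofReal (c / μ * (1 - 2 * (ν / c) * (Real.sqrt (1 + c / ν) - 1)))
      ≤ (P.rightInv i x).radius := by
  set r := c / μ * (1 - 2 * (ν / c) * (Real.sqrt (1 + c / ν) - 1)) with hr
  rcases le_total r 0 with h0 | h0
  · simp [ENNReal.ofReal_of_nonpos h0]
  · refine le_radius_of_eventually_le _ ((1 - (Real.sqrt (1 + c / ν))⁻¹) / μ) ?_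
    filter_upwards [Filter.Ici_mem_atTop 1] with n (hn : 1 ≤ n)
    rw [Real.coe_toNNReal _ h0, le_div_iff₀' hμ]
    refine le_trans ?_ (sum_norm_rightInv_le P i x hc hν hμ h0 hi hP hr.le (n := n + 1) (by omega))
    rw [mul_comm ‖_‖]
    gcongr
    exact Finset.single_le_sum (f := fun k => r ^ k * ‖P.rightInv i x k‖)
      (fun k _ => by positivity) (by simp [hn])

/-- Replacing the arguments one at a time gives `n` differences, each with `n - 1` remaining
arguments of norm at most `ρ`. -/
theorem norm_sub_le_of_norm_le (Q : FormalMultilinearSeries 𝕜 E F) {ρ : ℝ} (n : ℕ) {y₁ y₂ : E}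
    (h₁ : ‖y₁‖ ≤ ρ) (h₂ : ‖y₂‖ ≤ ρ) :
    ‖(Q n fun _ => y₁) - (Q n fun _ => y₂)‖ ≤ n * (‖Q n‖ * ρ ^ (n - 1)) * ‖y₁ - y₂‖ := by
  rcases n with _ | n
  · rw [show (fun _ : Fin 0 => y₁) = fun _ => y₂ from Subsingleton.elim _ _]
    simp
  · have h := (Q (n + 1)).norm_image_sub_le (fun _ => y₁) (fun _ => y₂)
    rw [show (fun _ : Fin (n + 1) => y₁) - (fun _ => y₂) = fun _ => y₁ - y₂ from rfl,
      pi_norm_const, pi_norm_const, pi_norm_const, Fintype.card_fin] at h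
    refine h.trans ?_
    rw [mul_comm ‖Q (n + 1)‖, mul_assoc ((n + 1 : ℕ) : ℝ)]
    gcongr
    exact max_le h₁ h₂

/-- On a closed ball strictly inside the disk of convergence, the sum of a power series is
Lipschitz. -/
theorem exists_lipschitz_of_lt_radius (Q : FormalMultilinearSeries 𝕜 E F) {ρ : NNReal}
    (hρ : 0 < ρ) (h : (ρ : ℝ≥0∞) < Q.radius) :
    ∃ M : ℝ, ∀ y₁ y₂ : E, ‖y₁‖ ≤ ρ → ‖y₂‖ ≤ ρ → ∀ z₁ z₂ : F,
      HasSum (fun j => Q j fun _ => y₁) z₁ → HasSum (fun j => Q j fun _ => y₂) z₂ →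
      ‖z₁ - z₂‖ ≤ M * ‖y₁ - y₂‖ := by
  -- The gap below the radius gives geometric decay of `‖Q n‖ ρ ^ n`, which absorbs the factor `n`
  -- of the derivative series; the sum of that series is `M`.
  obtain ⟨b, hb, C, -, hbd⟩ := Q.norm_mul_pow_le_mul_pow_of_lt_radius h
  have hρ' : (0 : ℝ) < ρ := hρ
  have hsum : Summable fun n : ℕ => (n : ℝ) * (‖Q n‖ * (ρ : ℝ) ^ (n - 1)) := by
    refine Summable.of_nonneg_of_le (fun n => by positivity) (fun n => ?_)
      ((summable_pow_mul_geometric_of_norm_lt_one 1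
        (by rw [Real.norm_of_nonneg hb.1.le]; exact hb.2 : ‖b‖ < 1)).mul_left (C / ρ))
    rcases n with _ | n
    · simp
    · have h2 : ‖Q (n + 1)‖ * (ρ : ℝ) ^ n ≤ C / ρ * b ^ (n + 1) := by
        rw [div_mul_eq_mul_div, le_div_iff₀ hρ', mul_assoc, ← pow_succ]
        exact hbd (n + 1)
      rw [pow_one, mul_left_comm (C / (ρ : ℝ))]
      exact mul_le_mul_of_nonneg_left h2 (Nat.cast_nonneg _)
  refine ⟨∑' n : ℕ, (n : ℝ) * (‖Q n‖ * (ρ : ℝ) ^ (n - 1)),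
    fun y₁ y₂ h₁ h₂ z₁ z₂ hz₁ hz₂ => ?_⟩
  have hz := hz₁.sub hz₂
  have hM := hsum.hasSum.mul_right ‖y₁ - y₂‖
  exact hz.norm_le_of_bounded hM fun n => Q.norm_sub_le_of_norm_le n h₁ h₂

end FormalMultilinearSeries

/-! ### Inequalities in finite `ℓ^p` spaces. -/

namespace PiLp

variable {ι κ : Type*} [Fintype ι] [Fintype κ]

/-- **Hölder's inequality** for finite `ℓ^p` spaces. -/
theorem sum_norm_mul_norm_le (p q : ℝ≥0∞) [hpq : p.HolderConjugate q] {α β : ι → Type*}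
    [∀ i, SeminormedAddCommGroup (α i)] [∀ i, SeminormedAddCommGroup (β i)]
    (f : PiLp p α) (g : PiLp q β) : ∑ i, ‖f i‖ * ‖g i‖ ≤ ‖f‖ * ‖g‖ := by
  have hpq' := ENNReal.holderConjugate_iff.1 hpq
  rcases eq_or_ne p ∞ with rfl | hp
  · obtain rfl : q = 1 := by simpa using hpq'
    rw [norm_eq_of_L1, Finset.mul_sum]
    gcongr with i
    exact norm_apply_le f i
  rcases eq_or_ne q ∞ with rfl | hq
  · obtain rfl : p = 1 := by simpa using hpq'
    rw [norm_eq_of_L1, Finset.sum_mul]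
    gcongr with i
    exact norm_apply_le g i
  have h := ENNReal.HolderConjugate.toReal_of_ne_top (p := p) (q := q) hp hq
  rw [norm_eq_sum h.pos, norm_eq_sum h.symm.pos]
  exact Real.inner_le_Lp_mul_Lq_of_nonneg _ h (fun _ _ => norm_nonneg _) fun _ _ => norm_nonneg _

theorem norm_mono (p : ℝ≥0∞) [Fact (1 ≤ p)] {α β : ι → Type*}
    [∀ i, SeminormedAddCommGroup (α i)] [∀ i, SeminormedAddCommGroup (β i)]
    {f : PiLp p α} {g : PiLp p β} (h : ∀ i, ‖f i‖ ≤ ‖g i‖) : ‖f‖ ≤ ‖g‖ := by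
  rcases eq_or_ne p ∞ with rfl | hp
  · rw [norm_eq_ciSup]
    exact Real.iSup_le (fun i => (h i).trans (norm_apply_le g i)) (norm_nonneg _)
  · have hp0 : 0 < p.toReal := ENNReal.toReal_pos (zero_lt_one.trans_le Fact.out).ne' hp
    rw [norm_eq_sum hp0, norm_eq_sum hp0]
    gcongr with i
    exact h i

/-- The `ℓ^p` norm of a pure tensor is at most the product of the `ℓ^p` norms. -/
theorem norm_tensor_le (p : ℝ≥0∞) [Fact (1 ≤ p)] (f : ι → ℝ) (g : κ → ℝ) :
    ‖(WithLp.toLp p fun x : ι × κ => f x.1 * g x.2 : PiLp p fun _ : ι × κ => ℝ)‖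
      ≤ ‖(WithLp.toLp p f : PiLp p fun _ : ι => ℝ)‖
        * ‖(WithLp.toLp p g : PiLp p fun _ : κ => ℝ)‖ := by
  rcases eq_or_ne p ∞ with rfl | hp
  · rw [norm_eq_ciSup]
    refine Real.iSup_le (fun x => ?_) (by positivity)
    rw [toLp_apply, norm_mul]
    exact mul_le_mul (norm_apply_le (WithLp.toLp ∞ f : PiLp ∞ fun _ : ι => ℝ) x.1)
      (norm_apply_le (WithLp.toLp ∞ g : PiLp ∞ fun _ : κ => ℝ) x.2) (norm_nonneg _) (norm_nonneg _)
  · have hp0 : 0 < p.toReal := ENNReal.toReal_pos (zero_lt_one.trans_le Fact.out).ne' hp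
    rw [norm_eq_sum hp0, norm_eq_sum hp0, norm_eq_sum hp0,
      ← Real.mul_rpow (by positivity) (by positivity), Finset.sum_mul_sum,
      Fintype.sum_prod_type]
    simp only [norm_mul, Real.mul_rpow (norm_nonneg _) (norm_nonneg _)]
    exact le_rfl

end PiLp

/-! ### Norm bounds for the forward Born operators. -/

namespace GraphTomography

variable {W : Type*} {Γ : SimpleGraph W} [Fintype W] {G : Γ.Subgraph}

/-- The column of a matrix on `V ∪ δV` restricted to the rows in `V`, as an element of `ℓ^q(V)`. -/
def interiorCol (q : ℝ≥0∞) (A : Matrix (Node G) (Node G) ℂ) (x : Node G) :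
    PiLp q fun _ : ↥G.verts => ℂ :=
  WithLp.toLp q fun w => A (Sum.inl w) x

/-- The row of a matrix on `V ∪ δV` restricted to the columns in `V`, as an element of
`ℓ^q(V)`. -/
def interiorRow (q : ℝ≥0∞) (A : Matrix (Node G) (Node G) ℂ) (x : Node G) :
    PiLp q fun _ : ↥G.verts => ℂ :=
  WithLp.toLp q fun w => A x (Sum.inl w)

theorem bornChain_succ_apply (α₀ t : ℝ) (j : ℕ) (η : Fin (j + 1) → ↥G.verts → ℂ) (x y : Node G) :
    bornChain G α₀ t (j + 1) η x y = ∑ v : ↥G.verts,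
      (η 0 v * bornChain G α₀ t j (Fin.tail η) (Sum.inl v) y) *
        greenMatrix G α₀ t x (Sum.inl v) := by
  rw [bornChain, Matrix.mul_apply]
  refine Finset.sum_congr rfl fun v _ => ?_
  rw [Matrix.mul_diagonal]
  simp only [Matrix.submatrix_apply, id]
  ring

theorem sum_norm_mul_bornChain_le (α₀ t : ℝ) (p q : ℝ≥0∞) [p.HolderConjugate q] (j : ℕ)
    (η : Potential G p) (ζ : Fin j → ↥G.verts → ℂ) (y : Node G) :
    ∑ v : ↥G.verts, ‖η v * bornChain G α₀ t j ζ (Sum.inl v) y‖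
      ≤ ‖η‖ * ‖interiorCol q (bornChain G α₀ t j ζ) y‖ := by
  simp only [norm_mul]
  exact PiLp.sum_norm_mul_norm_le p q η (interiorCol q (bornChain G α₀ t j ζ) y)

theorem norm_interiorCol_green_le (α₀ t : ℝ) (q : ℝ≥0∞) (v : ↥G.verts) :
    ‖interiorCol q (greenMatrix G α₀ t) (Sum.inl v)‖ ≤
      ⨆ v : ↥G.verts, ‖interiorCol q (greenMatrix G α₀ t) (Sum.inl v)‖ :=
  le_ciSup (f := fun v => ‖interiorCol q (greenMatrix G α₀ t) (Sum.inl v)‖)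
    (Set.finite_range _).bddAbove v

/-- A column of the longer chain is a linear combination of columns of `G₀^{V;V}`, each of `ℓ^q`
norm at most the supremum. Hölder bounds the sum of the absolute coefficients by `‖η 0‖` times the
`ℓ^q` norm of the shorter chain's column. -/
theorem norm_interiorCol_bornChain_le (α₀ t : ℝ) (p q : ℝ≥0∞) [Fact (1 ≤ p)] [Fact (1 ≤ q)]
    [p.HolderConjugate q] (j : ℕ) (η : Fin j → Potential G p) (y : Node G) :
    ‖interiorCol q (bornChain G α₀ t j fun i => (η i).ofLp) y‖ ≤
      (⨆ v : ↥G.verts, ‖interiorCol q (greenMatrix G α₀ t) (Sum.inl v)‖) ^ j * (∏ i, ‖η i‖) *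
        ‖interiorCol q (greenMatrix G α₀ t) y‖ := by
  set m := ⨆ v : ↥G.verts, ‖interiorCol q (greenMatrix G α₀ t) (Sum.inl v)‖ with hm
  have hm0 : 0 ≤ m := Real.iSup_nonneg fun _ => norm_nonneg _
  induction j with
  | zero => simp [bornChain]
  | succ j ih =>
    have hexp : interiorCol q (bornChain G α₀ t (j + 1) fun i => (η i).ofLp) y =
        ∑ v : ↥G.verts, (η 0 v * bornChain G α₀ t j (fun i => (Fin.tail η i).ofLp) (Sum.inl v) y) •
          interiorCol q (greenMatrix G α₀ t) (Sum.inl v) := by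
      ext w
      rw [WithLp.ofLp_sum, Finset.sum_apply]
      exact bornChain_succ_apply α₀ t j (fun i => (η i).ofLp) (Sum.inl w) y
    calc ‖interiorCol q (bornChain G α₀ t (j + 1) fun i => (η i).ofLp) y‖
        ≤ ∑ v : ↥G.verts,
            ‖η 0 v * bornChain G α₀ t j (fun i => (Fin.tail η i).ofLp) (Sum.inl v) y‖ * m := by
          rw [hexp]
          refine norm_sum_le_of_le _ fun v _ => ?_
          rw [norm_smul]
          gcongr
          exact norm_interiorCol_green_le α₀ t q v
      _ ≤ (‖η 0‖ * (m ^ j * (∏ i, ‖Fin.tail η i‖) *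
            ‖interiorCol q (greenMatrix G α₀ t) y‖)) * m := by
          rw [← Finset.sum_mul]
          gcongr
          refine (sum_norm_mul_bornChain_le α₀ t p q j (η 0) _ y).trans ?_
          gcongr
          exact ih (Fin.tail η)
      _ = _ := by
          rw [Fin.prod_univ_succ]
          simp only [Fin.tail]
          ring

theorem norm_bornChain_succ_le (α₀ t : ℝ) (p q : ℝ≥0∞) [Fact (1 ≤ p)] [Fact (1 ≤ q)]
    [p.HolderConjugate q] (j : ℕ) (η : Fin (j + 1) → Potential G p) (x y : Node G) :
    ‖bornChain G α₀ t (j + 1) (fun i => (η i).ofLp) x y‖ ≤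
      (⨆ v : ↥G.verts, ‖interiorCol q (greenMatrix G α₀ t) (Sum.inl v)‖) ^ j * (∏ i, ‖η i‖) *
        (‖interiorRow q (greenMatrix G α₀ t) x‖ * ‖interiorCol q (greenMatrix G α₀ t) y‖) := by
  rw [bornChain_succ_apply]
  calc _ ≤ ∑ v : ↥G.verts, ‖η 0 v * bornChain G α₀ t j (fun i => (Fin.tail η i).ofLp)
            (Sum.inl v) y‖ * ‖interiorRow q (greenMatrix G α₀ t) x‖ := by
        refine norm_sum_le_of_le _ fun v _ => ?_
        rw [norm_mul]
        refine mul_le_mul_of_nonneg_left ?_ (norm_nonneg _)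
        exact PiLp.norm_apply_le (interiorRow q (greenMatrix G α₀ t) x) v
    _ ≤ (‖η 0‖ * ((⨆ v : ↥G.verts, ‖interiorCol q (greenMatrix G α₀ t) (Sum.inl v)‖) ^ j *
          (∏ i, ‖Fin.tail η i‖) * ‖interiorCol q (greenMatrix G α₀ t) y‖)) *
          ‖interiorRow q (greenMatrix G α₀ t) x‖ := by
        rw [← Finset.sum_mul]
        gcongr
        refine (sum_norm_mul_bornChain_le α₀ t p q j (η 0) _ y).trans ?_
        gcongr
        exact norm_interiorCol_bornChain_le α₀ t p q j (Fin.tail η) y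
    _ = _ := by
        rw [Fin.prod_univ_succ]
        simp only [Fin.tail]
        ring

variable (R S : Set ↥(boundary G)) (α₀ t : ℝ) (p q : ℝ≥0∞) [Fact (1 ≤ p)]

theorem nuConst_nonneg (hα : 0 ≤ α₀) [Fact (1 ≤ q)] : 0 ≤ nuConst R S α₀ t p q := by
  unfold nuConst; positivity

theorem muConst_nonneg (G : Γ.Subgraph) (hα : 0 ≤ α₀) [Fact (1 ≤ q)] : 0 ≤ muConst G α₀ t q :=
  mul_nonneg hα (Real.iSup_nonneg fun _ => norm_nonneg _)

/-- The forward Born operators satisfy `‖K_{j+1}‖ ≤ ν_p μ_p^j`. -/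
theorem norm_bornOp_succ_le (hα : 0 ≤ α₀) [Fact (1 ≤ q)] [p.HolderConjugate q] (j : ℕ) :
    ‖bornOp R S α₀ t p (j + 1)‖ ≤ nuConst R S α₀ t p q * muConst G α₀ t q ^ j := by
  have hν := nuConst_nonneg R S α₀ t p q hα
  have hμ := muConst_nonneg α₀ t q G hα
  refine ContinuousMultilinearMap.opNorm_le_bound (by positivity) fun η => ?_
  set m := ⨆ v : ↥G.verts, ‖interiorCol q (greenMatrix G α₀ t) (Sum.inl v)‖ with hm
  have hm0 : 0 ≤ m := Real.iSup_nonneg fun _ => norm_nonneg _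
  set f : ↥R → ℝ := fun r => ‖interiorRow q (greenMatrix G α₀ t) (Sum.inr r)‖ with hf
  set g : ↥S → ℝ := fun s => ‖interiorCol q (greenMatrix G α₀ t) (Sum.inr s)‖ with hg
  -- One factor `α₀` belongs to `ν_p`; the other `j` combine with `m ^ j` into `μ_p ^ j`. The
  -- remaining dependence on `(r, s)` is dominated by the product `f r * g s`.
  set c : ℝ := α₀ ^ (j + 1) * (m ^ j * ∏ i, ‖η i‖) with hc
  have hc0 : 0 ≤ c := by positivity
  have h1 : ‖bornOp R S α₀ t p (j + 1) η‖ ≤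
      ‖c • (WithLp.toLp p fun x : ↥R × ↥S => f x.1 * g x.2 : PiLp p fun _ : ↥R × ↥S => ℝ)‖ := by
    refine PiLp.norm_mono p fun rs => ?_
    have h := norm_bornChain_succ_le α₀ t p q j η (Sum.inr rs.1) (Sum.inr rs.2)
    have e1 : ‖(bornOp R S α₀ t p (j + 1) η) rs‖ = α₀ ^ (j + 1) *
        ‖bornChain G α₀ t (j + 1) (fun i => (η i).ofLp) (Sum.inr rs.1) (Sum.inr rs.2)‖ := by
      change ‖-(-(α₀ : ℂ)) ^ (j + 1) * bornChain G α₀ t (j + 1) (fun i => (η i).ofLp)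
        (Sum.inr rs.1) (Sum.inr rs.2)‖ = _
      rw [norm_mul, norm_neg, norm_pow, norm_neg, Complex.norm_real, Real.norm_of_nonneg hα]
    have e2 : ‖(c • (WithLp.toLp p fun x : ↥R × ↥S => f x.1 * g x.2 :
        PiLp p fun _ : ↥R × ↥S => ℝ)) rs‖ = c * (f rs.1 * g rs.2) := by
      rw [PiLp.smul_apply, smul_eq_mul]
      exact Real.norm_of_nonneg (mul_nonneg hc0 (mul_nonneg (norm_nonneg _) (norm_nonneg _)))
    rw [e1, e2, hc, mul_assoc]
    exact mul_le_mul_of_nonneg_left h (by positivity)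
  refine h1.trans ?_
  rw [norm_smul, Real.norm_of_nonneg hc0]
  refine (mul_le_mul_of_nonneg_left (PiLp.norm_tensor_le p f g) hc0).trans (le_of_eq ?_)
  have e1 : nuConst R S α₀ t p q = α₀ * ‖(WithLp.toLp p f : PiLp p fun _ : ↥R => ℝ)‖ *
      ‖(WithLp.toLp p g : PiLp p fun _ : ↥S => ℝ)‖ := rfl
  have e2 : muConst G α₀ t q = α₀ * m := rfl
  rw [e1, e2, hc]
  ring

theorem norm_bornSeries_le (hα : 0 ≤ α₀) [Fact (1 ≤ q)] [p.HolderConjugate q]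
    (hμ : 0 < muConst G α₀ t q) (n : ℕ) :
    ‖bornSeries R S α₀ t p n‖ ≤
      nuConst R S α₀ t p q / muConst G α₀ t q * muConst G α₀ t q ^ n := by
  have hν := nuConst_nonneg R S α₀ t p q hα
  rcases n with _ | n
  · have : bornSeries R S α₀ t p 0 = 0 := rfl
    rw [this, norm_zero]
    positivity
  · refine (norm_bornOp_succ_le R S α₀ t p q hα n).trans (le_of_eq ?_)
    rw [pow_succ]
    field_simp

/-! ### The linear term, its inverse, and the radius of the inverse Born series. -/

theorem norm_bornLinear_le (hα : 0 ≤ α₀) [Fact (1 ≤ q)] [p.HolderConjugate q] :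
    ‖bornLinear R S α₀ t p‖ ≤ nuConst R S α₀ t p q := by
  rw [bornLinear, LinearIsometryEquiv.norm_map]
  exact (norm_bornOp_succ_le R S α₀ t p q hα 0).trans_eq (by rw [pow_zero, mul_one])

theorem lowerConst_mul_norm_le (η : Potential G p) :
    lowerConst R S α₀ t p * ‖η‖ ≤ ‖bornLinear R S α₀ t p η‖ := by
  rcases eq_or_ne η 0 with rfl | hη
  · simp
  have hη' : 0 < ‖η‖ := norm_pos_iff.2 hη
  have h : lowerConst R S α₀ t p ≤ ‖bornLinear R S α₀ t p ((‖η‖⁻¹ : ℂ) • η)‖ := by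
    refine csInf_le ⟨0, ?_⟩ ⟨(‖η‖⁻¹ : ℂ) • η, ?_, rfl⟩
    · rintro _ ⟨η, -, rfl⟩
      exact norm_nonneg _
    · rw [norm_smul, norm_inv, Complex.norm_real, norm_norm, inv_mul_cancel₀ hη'.ne']
  rw [map_smul, norm_smul, norm_inv, Complex.norm_real, norm_norm, inv_mul_eq_div,
    le_div_iff₀ hη'] at h
  exact h

theorem coe_bornEquiv (hK : Function.Bijective (bornLinear R S α₀ t p)) :
    (bornEquiv R S α₀ t p hK : Potential G p →L[ℂ] Data R S p) = bornLinear R S α₀ t p := rfl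

/-- `‖K₁⁻¹‖⁻¹` is a positive lower bound on the unit sphere. Nontriviality makes the sphere
nonempty, which excludes the default `sInf ∅ = 0`. -/
theorem lowerConst_pos [Nontrivial (Potential G p)]
    (hK : Function.Bijective (bornLinear R S α₀ t p)) : 0 < lowerConst R S α₀ t p := by
  set e := bornEquiv R S α₀ t p hK with he
  have hpos : 0 < ‖(e.symm : Data R S p →L[ℂ] Potential G p)‖ := e.norm_symm_pos
  obtain ⟨η, hη⟩ := exists_norm_eq (Potential G p) zero_le_one
  refine (inv_pos.2 hpos).trans_le (le_csInf ⟨_, η, hη, rfl⟩ ?_)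
  rintro _ ⟨ζ, hζ, rfl⟩
  rw [inv_le_iff_one_le_mul₀' hpos, ← hζ]
  have h := (e.symm : Data R S p →L[ℂ] Potential G p).le_opNorm (e ζ)
  rwa [ContinuousLinearEquiv.coe_coe, e.symm_apply_apply] at h

theorem norm_bornEquiv_symm_le [Nontrivial (Potential G p)]
    (hK : Function.Bijective (bornLinear R S α₀ t p)) :
    ‖((bornEquiv R S α₀ t p hK).symm : Data R S p →L[ℂ] Potential G p)‖ ≤
      (lowerConst R S α₀ t p)⁻¹ := by
  have hc := lowerConst_pos R S α₀ t p hK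
  refine ContinuousLinearMap.opNorm_le_bound _ (inv_nonneg.2 hc.le) fun φ => ?_
  rw [inv_mul_eq_div, le_div_iff₀' hc]
  refine (lowerConst_mul_norm_le R S α₀ t p _).trans (le_of_eq ?_)
  rw [← coe_bornEquiv R S α₀ t p hK]
  simp

/-- Evaluation at a unit vector gives `0 < C_p ≤ ‖K₁‖ ≤ ν_p`. -/
theorem nuConst_pos (hα : 0 ≤ α₀) [Fact (1 ≤ q)] [p.HolderConjugate q]
    [Nontrivial (Potential G p)] (hK : Function.Bijective (bornLinear R S α₀ t p)) :
    0 < nuConst R S α₀ t p q := by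
  obtain ⟨η, hη⟩ := exists_norm_eq (Potential G p) zero_le_one
  have h1 := lowerConst_mul_norm_le R S α₀ t p η
  have h2 := (bornLinear R S α₀ t p).le_of_opNorm_le (norm_bornLinear_le R S α₀ t p q hα) η
  rw [hη, mul_one] at h1 h2
  linarith [lowerConst_pos R S α₀ t p hK]

/-- The radius of convergence of the inverse Born series is at least `r_p`. -/
theorem ofReal_convRadius_le_radius (hα : 0 ≤ α₀) [Fact (1 ≤ q)] [p.HolderConjugate q]
    [Nontrivial (Potential G p)] (hK : Function.Bijective (bornLinear R S α₀ t p)) :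
    ENNReal.ofReal (convRadius R S α₀ t p q) ≤ (inverseBornSeries R S α₀ t p hK).radius := by
  -- If `μ_p = 0`, division by zero makes `convRadius` equal to 0 and nothing is left to prove.
  rcases (muConst_nonneg α₀ t q G hα).eq_or_lt with h0 | hμ
  · simp [convRadius, ← h0]
  · have h1 : bornSeries R S α₀ t p 1 = (continuousMultilinearCurryFin1 ℂ (Potential G p)
        (Data R S p)).symm (bornEquiv R S α₀ t p hK : Potential G p →L[ℂ] Data R S p) := by
      rw [coe_bornEquiv, bornLinear, LinearIsometryEquiv.symm_apply_apply]
    rw [inverseBornSeries, FormalMultilinearSeries.leftInv_eq_rightInv _ _ _ h1]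
    exact FormalMultilinearSeries.ofReal_le_radius_rightInv _ _ _
      (lowerConst_pos R S α₀ t p hK) (nuConst_pos R S α₀ t p q hα hK) hμ
      (norm_bornEquiv_symm_le R S α₀ t p hK) (norm_bornSeries_le R S α₀ t p q hα hμ)

end GraphTomography

/-! ### Convergence and stability on compact sets of data. -/

open GraphTomography
theorem mainTheorem3 {W : Type*} [Fintype W] (Γ : SimpleGraph W) (G : Γ.Subgraph)
    (hG : G.Connected) (R S : Set ↥(boundary G)) (α₀ t : ℝ) (hα : 0 < α₀) (ht : 0 ≤ t)
    (p q : ℝ≥0∞) [Fact (1 ≤ p)] (hpq : p⁻¹ + q⁻¹ = 1)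
    (hcard : Fintype.card ↥G.verts = Fintype.card (↥R × ↥S))
    (hK : Function.Bijective (bornLinear R S α₀ t p))
    (D : Set (Data R S p)) (hD : IsCompact D)
    (hDr : D ⊆ {φ | ‖φ‖ < convRadius R S α₀ t p q}) :
    (∀ φ ∈ D, ∃ ψ : Potential G p,
      HasSum (fun j : ℕ => inverseBornSeries R S α₀ t p hK j (fun _ => φ)) ψ) ∧
    ∃ M : ℝ, ∀ φ₁ ∈ D, ∀ φ₂ ∈ D, ∀ ψ₁ ψ₂ : Potential G p,
      HasSum (fun j : ℕ => inverseBornSeries R S α₀ t p hK j (fun _ => φ₁)) ψ₁ →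
      HasSum (fun j : ℕ => inverseBornSeries R S α₀ t p hK j (fun _ => φ₂)) ψ₂ →
      ‖ψ₁ - ψ₂‖ ≤ M * ‖φ₁ - φ₂‖ := by
  have : p.HolderConjugate q := ENNReal.holderConjugate_iff.2 hpq
  have : Fact (1 ≤ q) := ⟨ENNReal.inv_le_one.1 (hpq ▸ le_add_self)⟩
  have : Nonempty ↥G.verts := hG.nonempty.to_subtype
  have : Nontrivial (Potential G p) := (WithLp.equiv p (↥G.verts → ℂ)).nontrivial
  have hrad := ofReal_convRadius_le_radius R S α₀ t p q hα.le hK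
  -- `HasSum` is unconditional convergence, which is absolute convergence in the finite-dimensional
  -- space `ℓ^p(V)`.
  refine ⟨fun φ hφ => ⟨_, FormalMultilinearSeries.hasSum _ ?_⟩, ?_⟩
  · rw [Metric.mem_eball, edist_zero_right, ← ofReal_norm]
    exact (ENNReal.ofReal_lt_ofReal_iff ((norm_nonneg φ).trans_lt (hDr hφ))).2 (hDr hφ)
      |>.trans_le hrad
  · rcases D.eq_empty_or_nonempty with rfl | hne
    · exact ⟨0, by simp⟩
    -- The norm attains its maximum on `D`, below `r_p`, which leaves room for a radius `ρ` strictly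
    -- in between.
    obtain ⟨φ₀, hφ₀, hmax⟩ := hD.exists_isMaxOn hne continuous_norm.continuousOn
    have hφ₀r : ‖φ₀‖ < convRadius R S α₀ t p q := hDr hφ₀
    obtain ⟨ρ, hρ₁, hρ₂⟩ := exists_between hφ₀r
    have hρ0 : 0 < ρ := (norm_nonneg φ₀).trans_lt hρ₁
    lift ρ to NNReal using hρ0.le
    have hlt : (ρ : ℝ≥0∞) < (inverseBornSeries R S α₀ t p hK).radius := by
      refine lt_of_lt_of_le ?_ hrad
      rw [ENNReal.lt_ofReal_iff_toReal_lt ENNReal.coe_ne_top]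
      exact hρ₂
    obtain ⟨M, hM⟩ := FormalMultilinearSeries.exists_lipschitz_of_lt_radius _
      (NNReal.coe_pos.1 hρ0) hlt
    exact ⟨M, fun φ₁ h₁ φ₂ h₂ ψ₁ ψ₂ hψ₁ hψ₂ =>
      hM φ₁ φ₂ ((hmax h₁).trans hρ₁.le) ((hmax h₂).trans hρ₁.le) ψ₁ ψ₂ hψ₁ hψ₂⟩
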